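/- Let $(\mathcal X,\rho)$ be a metric space, let $X\subseteq\mathcal X$ be a finite set of $n$ points, and let $k\ge 2$ be an even integer with $k\le n/3$. For a finite set $S$ of even size let $\mathrm{MWM}(S)$ be the minimum total weight of a perfect matching of $S$, and let $\mathrm{MWM}_k(X)=\max_{Z\subseteq X,\,|Z|=k}\mathrm{MWM}(Z)$. A set $S$ is called a $C$-approximation if $S\subseteq X$, $|S|=k$ and $\mathrm{MWM}(S)\ge\frac1C\,\mathrm{MWM}_k(X)$. The algorithm MWMOffline is the following. (1) Run GMM: pick an arbitrary $y_1\in X$ and, for $p=2,\dots,k$, pick $y_p\in X$ maximizing the distance to $\{y_1,\dots,y_{p-1}\}$; let $Y=\{y_1,\dots,y_k\}$. (2) Partition $X$ into cells $S_1,\dots,S_k$ by putting each point in the cell of a closest center $y_j$. (3) Draw a uniformly random subset $\hat Z$ of $Y$; if $|\hat Z|$ is odd, remove an arbitrary element; call the result $Z$. (4) Start with $W=Z$ and, while $|W|<k$, add to $W$ two distinct points of $X\setminus(W\cup Y)$ that lie in the same cell. (5) Return whichever of $Y$ and $W$ has the larger minimum-weight matching cost. All ties and arbitrary choices may be resolved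 in any way: GMM's choices are made before the random subset is drawn, while the others may depend on the random draws. Then GMM can be run, and for every possible outcome of GMM: (a) the algorithm is well defined, that is, whenever $|W|<k$ a pair as required in step (4) exists, and the algorithm returns a set; (b) with probability at least $\frac1{4096}$ over the random subset, the returned set is a $65$-approximation, however the remaining arbitrary choices are made. Moreover, with enough repetitions (a number depending only on the error probability) the algorithm succeeds with high probability: (c) for every $\delta>0$ and every integer $T\ge 4096\ln(1/\delta)$, if the algorithm is run $T$ times with independent random subsets (where the GMM runs may be different, but are fixed before the random subsets are drawn) and a set with the largest matching cost among the $T$ returned sets is output, then with probability at least $1-\delta$ this set is a $65$-approximation, however the remaining arbitrary choices are made. In particular a constant number of repetitions gives success probability at least $0.99$. -/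

import Mathlib

namespace RemoteMatching

/-- A perfect matching of the finite set `S`, given by the map that sends each point of `S`
to its partner. -/
def IsPerfectMatching {α : Type*} (S : Finset α) (π : α → α) : Prop :=
  ∀ x ∈ S, π x ∈ S ∧ π x ≠ x ∧ π (π x) = x

/-- Total weight of a matching; every matched pair is met from both of its endpoints,
whence the factor `1/2`. -/
noncomputable def matchingCost {α : Type*} [MetricSpace α] (S : Finset α) (π : α → α) : ℝ :=
  (∑ x ∈ S, dist x (π x)) / 2

/-- Minimum weight of a perfect matching of `S` (meaningful for `S` of even size; the infimum
is over a finite nonempty set of values then). -/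
noncomputable def mwm {α : Type*} [MetricSpace α] (S : Finset α) : ℝ :=
  sInf {c : ℝ | ∃ π : α → α, IsPerfectMatching S π ∧ c = matchingCost S π}

/-- The remote-matching optimum: the maximum of `mwm Z` over the `k`-point subsets `Z` of `X`. -/
noncomputable def mwmOpt {α : Type*} [MetricSpace α] (X : Finset α) (k : ℕ) : ℝ :=
  sSup {c : ℝ | ∃ Z : Finset α, Z ⊆ X ∧ Z.card = k ∧ c = mwm Z}

/-- `S` is a `C`-approximate solution of remote-matching on `X` with parameter `k`. -/
def IsApprox {α : Type*} [MetricSpace α] (C : ℝ) (X : Finset α) (k : ℕ) (S : Finset α) : Prop :=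
  S ⊆ X ∧ S.card = k ∧ (1 / C) * mwmOpt X k ≤ mwm S

/-- `y 0, y 1, …, y (k-1)` is a possible run of the greedy algorithm GMM on `X`: the first point
is an arbitrary point of `X`, and each later one is a point of `X` at maximum distance from
the set of its predecessors (ties are broken arbitrarily). -/
def IsGMM {α : Type*} [MetricSpace α] (X : Finset α) {k : ℕ} (y : Fin k → α) : Prop :=
  (∀ p, y p ∈ X) ∧
  ∀ p : Fin k, 0 < p.val → ∀ x ∈ X,
    Metric.infDist x (y '' Set.Iio p) ≤ Metric.infDist (y p) (y '' Set.Iio p)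

/-- The set of centers. -/
def centers {α : Type*} [DecidableEq α] {k : ℕ} (y : Fin k → α) : Finset α :=
  Finset.univ.image y

/-- `σ` sends each point of `X` to (the index of) a closest center: the cells are
`{x ∈ X | σ x = j}`. Ties are broken arbitrarily. -/
def IsAssignment {α : Type*} [MetricSpace α] (X : Finset α) {k : ℕ} (y : Fin k → α)
    (σ : α → Fin k) : Prop :=
  ∀ x ∈ X, ∀ j, dist x (y (σ x)) ≤ dist x (y j)

/-- `Z` arises from `Zhat` by removing an arbitrary element if `Zhat` has odd size, and by doing
nothing otherwise. -/
def IsTrim {α : Type*} [DecidableEq α] (Zhat Z : Finset α) : Prop :=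
  (Even Zhat.card ∧ Z = Zhat) ∨ (Odd Zhat.card ∧ ∃ z ∈ Zhat, Z = Zhat.erase z)

/-- One pass of the padding loop: while `|W| < k`, add two distinct points of `X \ (W ∪ Y)`
that lie in the same cell. -/
def PadStep {α : Type*} [DecidableEq α] (X : Finset α) {k : ℕ} (y : Fin k → α) (σ : α → Fin k)
    (W W' : Finset α) : Prop :=
  W.card < k ∧ ∃ x ∈ X \ (W ∪ centers y), ∃ x' ∈ X \ (W ∪ centers y),
    x ≠ x' ∧ σ x = σ x' ∧ W' = insert x (insert x' W)

/-- `S` is a possible return value of the algorithm MWMOffline on `X` when GMM has produced `y`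
and the random subset drawn is `{y j | j ∈ R}`; all remaining choices (cells, removed element,
padding pairs, ties between the two candidates) are arbitrary. -/
def IsOutput {α : Type*} [MetricSpace α] [DecidableEq α] (X : Finset α) {k : ℕ} (y : Fin k → α)
    (R : Finset (Fin k)) (S : Finset α) : Prop :=
  ∃ (σ : α → Fin k) (Z W : Finset α),
    IsAssignment X y σ ∧ IsTrim (R.image y) Z ∧
    Relation.ReflTransGen (PadStep X y σ) Z W ∧ ¬ W.card < k ∧
    (S = centers y ∨ S = W) ∧ mwm (centers y) ≤ mwm S ∧ mwm W ≤ mwm S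

/-- `S` is a possible result of running MWMOffline `T` times, the `t`-th time with GMM output
`y t` and random index set `R t`, and returning a best one of the `T` sets obtained. -/
def IsRepeatedOutput {α : Type*} [MetricSpace α] [DecidableEq α] (X : Finset α) {k T : ℕ}
    (y : Fin T → Fin k → α) (R : Fin T → Finset (Fin k)) (S : Finset α) : Prop :=
  ∃ Q : Fin T → Finset α,
    (∀ t, IsOutput X (y t) (R t) (Q t)) ∧ (∃ t, S = Q t) ∧ ∀ t, mwm (Q t) ≤ mwm S

end RemoteMatching

open RemoteMatching

/-! Minimum matching cost is subadditive under symmetric difference on even sets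
(`mwm_symmDiff_le`): the union of two matchings splits into paths and cycles, and each path can be
shortcut to one edge. GMM yields a radius r that bounds both the distance of every point to its
center from above and the distances between centers from below (`IsGMM.exists_radius`). Three
estimates follow. Moving an optimal set to its centers gives an even set U of centers with optimum ≤
mwm U + k r. Padding Z to W costs at most k r. All k centers together have mwm Y ≥ k r / 2. For even
A, one of A and A ∆ U carries at least half of mwm U. Hence at least half of the even subsets, so a
quarter of all subsets, are good. For these the optimum is at most 2 mwm Z + k r ≤ 2 mwm W + 3 k r ≤
8 mwm S. Both 65 and 1/4096 therefore leave slack. Repetition amplifies the probability as usual. -/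

namespace RemoteMatching

open scoped symmDiff

/-! ### Parity of symmetric differences -/

theorem even_card_symmDiff {α : Type*} [DecidableEq α] (A B : Finset α) :
    Even (A ∆ B).card ↔ (Even A.card ↔ Even B.card) := by
  have h : (A ∆ B).card = (A \ B).card + (B \ A).card := by
    rw [symmDiff_def, Finset.sup_eq_union]
    exact Finset.card_union_of_disjoint disjoint_sdiff_sdiff
  have h1 := Finset.card_sdiff_add_card_inter A B
  have h2 := Finset.card_sdiff_add_card_inter B A
  rw [Finset.inter_comm] at h2
  rw [h, ← h1, ← h2]
  simp only [Nat.even_add]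
  tauto

theorem even_card_pair_symmDiff {α : Type*} [DecidableEq α] (a b : α) :
    Even (({a} : Finset α) ∆ {b}).card := by
  simp [even_card_symmDiff]

/-- Puts padding and growing a matching into the form of symmetric differences with a pair, where
the calculus of `∆` applies. -/
theorem insert_insert_eq_symmDiff {α : Type*} [DecidableEq α] {S : Finset α} {a b : α}
    (hab : a ≠ b) (ha : a ∉ S) (hb : b ∉ S) :
    insert a (insert b S) = S ∆ ({a} ∆ {b}) := by
  ext x
  simp only [Finset.mem_insert, Finset.mem_symmDiff, Finset.mem_singleton]
  by_cases hxa : x = a <;> by_cases hxb : x = b <;> subst_vars <;> simp_all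

section Combinatorics

variable {α : Type*} [DecidableEq α] {X : Finset α} {k : ℕ} {y : Fin k → α}

/-! ### Trimming and padding -/

theorem exists_isTrim (A : Finset α) : ∃ Z, IsTrim A Z := by
  rcases Nat.even_or_odd A.card with h | h
  · exact ⟨A, Or.inl ⟨h, rfl⟩⟩
  · obtain ⟨z, hz⟩ := Finset.card_pos.1 h.pos
    exact ⟨_, Or.inr ⟨h, z, hz, rfl⟩⟩

theorem IsTrim.subset {A Z : Finset α} (h : IsTrim A Z) : Z ⊆ A := by
  rcases h with ⟨-, rfl⟩ | ⟨-, z, -, rfl⟩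
  · exact subset_rfl
  · exact Finset.erase_subset _ _

theorem IsTrim.even_card {A Z : Finset α} (h : IsTrim A Z) : Even Z.card := by
  rcases h with ⟨h, rfl⟩ | ⟨h, z, hz, rfl⟩
  · exact h
  · rw [Finset.card_erase_of_mem hz]
    exact Nat.Odd.sub_odd h odd_one

theorem IsTrim.eq_of_even {A Z : Finset α} (h : IsTrim A Z) (hA : Even A.card) : Z = A := by
  rcases h with ⟨-, rfl⟩ | ⟨h, -⟩
  · rfl
  · exact absurd hA (Nat.not_even_iff_odd.2 h)

theorem PadStep.exists_eq_symmDiff {σ : α → Fin k} {W W' : Finset α} (h : PadStep X y σ W W') :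
    ∃ x ∈ X, ∃ x' ∈ X, σ x = σ x' ∧ W'.card = W.card + 2 ∧ W' = W ∆ ({x} ∆ {x'}) := by
  obtain ⟨-, x, hx, x', hx', hne, hσ, rfl⟩ := h
  simp only [Finset.mem_sdiff, Finset.mem_union, not_or] at hx hx'
  refine ⟨x, hx.1, x', hx'.1, hσ, ?_, insert_insert_eq_symmDiff hne hx.2.1 hx'.2.1⟩
  rw [Finset.card_insert_of_notMem (by simp [hne, hx.2.1]),
    Finset.card_insert_of_notMem hx'.2.1]

/-- Parity prevents overshooting: an even size below the even number k is at most k - 2. -/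
theorem padding_invariant (hk : Even k) {σ : α → Fin k} {Z W : Finset α} (hZX : Z ⊆ X)
    (hZ : Even Z.card) (hZk : Z.card ≤ k)
    (h : Relation.ReflTransGen (PadStep X y σ) Z W) :
    W ⊆ X ∧ Even W.card ∧ W.card ≤ k := by
  induction h with
  | refl => exact ⟨hZX, hZ, hZk⟩
  | tail _ hs ih =>
    obtain ⟨x, hx, x', hx', -, hc, he⟩ := hs.exists_eq_symmDiff
    obtain ⟨hlt, -⟩ := hs
    obtain ⟨ih1, ih2, ih3⟩ := ih
    refine ⟨?_, by rw [hc]; exact ih2.add even_two, ?_⟩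
    · rw [he]
      intro z hz
      simp only [Finset.mem_symmDiff, Finset.mem_singleton] at hz
      rcases hz with hz | ⟨⟨rfl, -⟩ | ⟨rfl, -⟩, -⟩
      · exact ih1 hz.1
      · exact hx
      · exact hx'
    · obtain ⟨a, ha⟩ := ih2
      obtain ⟨b, hb⟩ := hk
      omega

/-- Pigeonhole: W and the centers occupy fewer than 2k points, so more than k points remain for the
k cells. -/
theorem exists_padStep (hn : 3 * k ≤ X.card) (σ : α → Fin k) {W : Finset α}
    (hlt : W.card < k) : ∃ W', PadStep X y σ W W' := by
  have hc : (centers y).card ≤ k := Finset.card_image_le.trans (by simp)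
  have h1 := Finset.card_union_le W (centers y)
  have h2 := Finset.le_card_sdiff (W ∪ centers y) X
  have hlarge : (Finset.univ : Finset (Fin k)).card < (X \ (W ∪ centers y)).card := by
    rw [Finset.card_fin]
    omega
  obtain ⟨x, hx, x', hx', hne, hσ⟩ :=
    Finset.exists_ne_map_eq_of_card_lt_of_maps_to hlarge (f := σ) (by simp)
  exact ⟨_, hlt, x, hx, x', hx', hne, hσ, rfl⟩

theorem exists_padding (hn : 3 * k ≤ X.card) (σ : α → Fin k) (Z : Finset α) :
    ∃ W, Relation.ReflTransGen (PadStep X y σ) Z W ∧ ¬ W.card < k := by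
  induction hm : k - Z.card using Nat.strong_induction_on generalizing Z with
  | _ m ih =>
    by_cases hlt : Z.card < k
    · obtain ⟨W, hs⟩ := exists_padStep hn σ (y := y) hlt
      obtain ⟨-, -, -, -, -, hc, -⟩ := hs.exists_eq_symmDiff
      obtain ⟨V, hV, hVk⟩ := ih (k - W.card) (by omega) W rfl
      exact ⟨V, .head hs hV, hVk⟩
    · exact ⟨Z, .refl, hlt⟩

theorem card_centers (hy : Function.Injective y) : (centers y).card = k := by
  simp [centers, Finset.card_image_of_injective _ hy]

theorem IsTrim.subset_centers {R : Finset (Fin k)} {Z : Finset α} (h : IsTrim (R.image y) Z) :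
    Z ⊆ centers y :=
  h.subset.trans (Finset.image_subset_image (Finset.subset_univ R))

end Combinatorics

section Greedy

variable {α : Type*} [MetricSpace α] {X : Finset α} {k : ℕ} {y : Fin k → α}

/-! ### The greedy algorithm -/

/-- The sequence in which each term is chosen by `g` from the set of its predecessors. -/
noncomputable def greedySeq (g : Set α → α) : ℕ → α
  | n => g (Set.range fun m : Fin n => greedySeq g m.val)
decreasing_by exact m.isLt

theorem exists_isGMM {X : Finset α} (hX : X.Nonempty) (k : ℕ) :
    ∃ y : Fin k → α, IsGMM X y := by
  choose g hgX hg using fun s : Set α => X.exists_max_image (fun x => Metric.infDist x s) hX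
  refine ⟨fun p => greedySeq g p.val, fun p => ?_, fun p _ x hx => ?_⟩
  · change greedySeq g p.val ∈ X
    rw [greedySeq]
    exact hgX _
  · have hs : (fun p : Fin k => greedySeq g p.val) '' Set.Iio p
        = Set.range fun m : Fin p.val => greedySeq g m.val := by
      ext z
      constructor
      · rintro ⟨q, hq, rfl⟩
        exact ⟨⟨q.val, hq⟩, rfl⟩
      · rintro ⟨m, rfl⟩
        exact ⟨⟨m.val, m.isLt.trans p.isLt⟩, m.isLt, rfl⟩
    rw [hs]
    have heq : greedySeq g p.val = g (Set.range fun m : Fin p.val => greedySeq g m.val) := by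
      rw [greedySeq]
    change _ ≤ Metric.infDist (greedySeq g p.val) _
    rw [heq]
    exact hg _ x hx

/-- When the later of the two centers was chosen, x was also a candidate, so x was no farther from
the centers chosen by then. -/
theorem IsGMM.infDist_range_le (hy : IsGMM X y) {x : α} (hx : x ∈ X) {i j : Fin k} (hij : i ≠ j) :
    Metric.infDist x (Set.range y) ≤ dist (y i) (y j) := by
  wlog hlt : i < j generalizing i j
  · rw [dist_comm]
    exact this hij.symm (lt_of_le_of_ne (not_lt.1 hlt) hij.symm)
  have hne : (y '' Set.Iio j).Nonempty := ⟨y i, i, hlt, rfl⟩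
  calc Metric.infDist x (Set.range y)
      ≤ Metric.infDist x (y '' Set.Iio j) :=
        Metric.infDist_le_infDist_of_subset (Set.image_subset_range _ _) hne
    _ ≤ Metric.infDist (y j) (y '' Set.Iio j) := hy.2 j (lt_of_le_of_lt (Nat.zero_le _) hlt) x hx
    _ ≤ dist (y j) (y i) := Metric.infDist_le_dist_of_mem ⟨i, hlt, rfl⟩
    _ = dist (y i) (y j) := dist_comm _ _

theorem IsAssignment.dist_le_infDist {σ : α → Fin k} (hσ : IsAssignment X y σ) {x : α}
    (hx : x ∈ X) : dist x (y (σ x)) ≤ Metric.infDist x (Set.range y) := by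
  rw [Metric.le_infDist (Set.range_nonempty_iff_nonempty.2 ⟨σ x⟩)]
  rintro _ ⟨j, rfl⟩
  exact hσ x hx j

theorem exists_isAssignment (X : Finset α) (hk : 0 < k) (y : Fin k → α) :
    ∃ σ, IsAssignment X y σ := by
  have : Nonempty (Fin k) := ⟨⟨0, hk⟩⟩
  choose σ hσ using fun x : α => Finite.exists_min fun j => dist x (y j)
  exact ⟨σ, fun x _ j => hσ x j⟩

/-- A covering radius of the centers that is at most their separation. -/
theorem IsGMM.exists_radius (hy : IsGMM X y) (hX : X.Nonempty) : ∃ r : ℝ, 0 ≤ r ∧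
    (∀ σ, IsAssignment X y σ → ∀ x ∈ X, dist x (y (σ x)) ≤ r) ∧
    ∀ i j, i ≠ j → r ≤ dist (y i) (y j) := by
  obtain ⟨z, hz, hmax⟩ := X.exists_max_image (fun x => Metric.infDist x (Set.range y)) hX
  exact ⟨_, Metric.infDist_nonneg, fun σ hσ x hx => (hσ.dist_le_infDist hx).trans (hmax x hx),
    fun i j hij => hy.infDist_range_le hz hij⟩

end Greedy

/-! ### Matchings built pair by pair -/

/-- `HasMatching S c`: the set `S` has a perfect matching of total weight `c`, presented as a
disjoint union of pairs. -/
inductive HasMatching {α : Type*} [MetricSpace α] [DecidableEq α] : Finset α → ℝ → Prop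
  | empty : HasMatching ∅ 0
  | pair {S : Finset α} {c : ℝ} (a b : α) : HasMatching S c → a ≠ b → a ∉ S → b ∉ S →
      HasMatching (insert a (insert b S)) (c + dist a b)

section Matching

variable {α : Type*} [MetricSpace α]

theorem matchingCost_nonneg (S : Finset α) (π : α → α) : 0 ≤ matchingCost S π :=
  div_nonneg (Finset.sum_nonneg fun _ _ => dist_nonneg) zero_le_two

theorem bddBelow_matchingCosts (S : Finset α) :
    BddBelow {c : ℝ | ∃ π : α → α, IsPerfectMatching S π ∧ c = matchingCost S π} :=
  ⟨0, by rintro c ⟨π, -, rfl⟩; exact matchingCost_nonneg S π⟩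

theorem mwm_nonneg (S : Finset α) : 0 ≤ mwm S :=
  Real.sInf_nonneg (by rintro c ⟨π, -, rfl⟩; exact matchingCost_nonneg S π)

theorem exists_eq_mwmOpt {X : Finset α} {k : ℕ} (hk : k ≤ X.card) :
    ∃ Z ⊆ X, Z.card = k ∧ mwmOpt X k = mwm Z := by
  have hfin : {c : ℝ | ∃ Z : Finset α, Z ⊆ X ∧ Z.card = k ∧ c = mwm Z}.Finite := by
    refine (X.powerset.finite_toSet.image mwm).subset ?_
    rintro c ⟨Z, hZ, -, rfl⟩
    exact ⟨Z, by simpa using hZ, rfl⟩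
  obtain ⟨Z, hZ, hc⟩ := Finset.exists_subset_card_eq hk
  exact (Set.Nonempty.csSup_mem ⟨_, Z, hZ, hc, rfl⟩ hfin : mwmOpt X k ∈ _) |>.imp
    fun Z h => ⟨h.1, h.2.1, h.2.2⟩

variable [DecidableEq α]

theorem HasMatching.exists_isPerfectMatching {S : Finset α} {c : ℝ} (h : HasMatching S c) :
    ∃ π : α → α, IsPerfectMatching S π ∧ c = matchingCost S π := by
  induction h with
  | empty => exact ⟨id, by simp [IsPerfectMatching], by simp [matchingCost]⟩
  | @pair S c a b _ hab ha hb ih =>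
    obtain ⟨π, hπ, rfl⟩ := ih
    have key : ∀ x ∈ S, (if x = a then b else if x = b then a else π x) = π x := by
      intro x hx
      rw [if_neg (ne_of_mem_of_not_mem hx ha), if_neg (ne_of_mem_of_not_mem hx hb)]
    refine ⟨fun x => if x = a then b else if x = b then a else π x, ?_, ?_⟩
    · intro x hx
      rw [Finset.mem_insert, Finset.mem_insert] at hx
      rcases hx with rfl | rfl | hx
      · simp [hab.symm]
      · simp [hab, hab.symm]
      · obtain ⟨h1, h2, h3⟩ := hπ x hx
        simp only [key x hx, key _ h1]
        exact ⟨by simp [h1], h2, h3⟩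
    · have hs : ∑ x ∈ S, dist x (if x = a then b else if x = b then a else π x)
          = ∑ x ∈ S, dist x (π x) :=
        Finset.sum_congr rfl fun x hx => by rw [key x hx]
      simp only [matchingCost]
      rw [Finset.sum_insert (by simp [hab, ha]), Finset.sum_insert hb, hs]
      simp only [if_true, if_neg hab.symm, dist_comm b a]
      ring

theorem IsPerfectMatching.hasMatching {S : Finset α} {π : α → α} (h : IsPerfectMatching S π) :
    HasMatching S (matchingCost S π) := by
  induction S using Finset.strongInduction with
  | H S ih =>
    rcases S.eq_empty_or_nonempty with rfl | ⟨a, ha⟩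
    · simpa [matchingCost] using HasMatching.empty
    · obtain ⟨hb, hba, hπ⟩ := h a ha
      have hb' : π a ∈ S.erase a := Finset.mem_erase.2 ⟨hba, hb⟩
      have hss : (S.erase a).erase (π a) ⊂ S :=
        (Finset.erase_ssubset hb').trans (Finset.erase_ssubset ha)
      have hm : IsPerfectMatching ((S.erase a).erase (π a)) π := by
        intro x hx
        simp only [Finset.mem_erase] at hx ⊢
        obtain ⟨h1, h2, h3⟩ := h x hx.2.2
        refine ⟨⟨fun e => hx.2.1 ?_, fun e => hx.1 ?_, h1⟩, h2, h3⟩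
        · rw [← h3, e, hπ]
        · rw [← h3, e]
      have := (ih _ hss hm).pair a (π a) hba.symm (by simp) (by simp)
      rw [Finset.insert_erase hb', Finset.insert_erase ha] at this
      convert this using 1
      simp only [matchingCost]
      rw [← Finset.add_sum_erase S _ ha, ← Finset.add_sum_erase _ _ hb', hπ, dist_comm (π a) a]
      ring

theorem exists_hasMatching {S : Finset α} (h : Even S.card) : ∃ c, HasMatching S c := by
  induction S using Finset.strongInduction with
  | H S ih =>
    rcases S.eq_empty_or_nonempty with rfl | ⟨a, ha⟩
    · exact ⟨0, .empty⟩
    · have h1 : 1 < S.card := by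
        have := Finset.card_pos.2 ⟨a, ha⟩
        obtain ⟨m, hm⟩ := h
        omega
      obtain ⟨b, hb, hba⟩ := Finset.exists_mem_ne h1 a
      have hb' : b ∈ S.erase a := Finset.mem_erase.2 ⟨hba, hb⟩
      have hss : (S.erase a).erase b ⊂ S :=
        (Finset.erase_ssubset hb').trans (Finset.erase_ssubset ha)
      have he : Even ((S.erase a).erase b).card := by
        rw [Finset.card_erase_of_mem hb', Finset.card_erase_of_mem ha]
        obtain ⟨m, hm⟩ := h
        exact ⟨m - 1, by omega⟩
      obtain ⟨c, hc⟩ := ih _ hss he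
      have := hc.pair a b hba.symm (by simp) (by simp)
      rw [Finset.insert_erase hb', Finset.insert_erase ha] at this
      exact ⟨_, this⟩

/-- Adding an edge to a matching and shortcutting the alternating path through it. -/
theorem HasMatching.symmDiff_pair {S : Finset α} {c : ℝ} (h : HasMatching S c) (a b : α) :
    ∃ c' ≤ c + dist a b, HasMatching (S ∆ ({a} ∆ {b})) c' := by
  induction h generalizing a b with
  | empty =>
    by_cases hab : a = b
    · subst hab
      exact ⟨0, by simp, by simpa using HasMatching.empty⟩
    · have := (HasMatching.empty (α := α)).pair a b hab (by simp) (by simp)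
      rw [insert_insert_eq_symmDiff hab (by simp) (by simp)] at this
      exact ⟨_, le_rfl, this⟩
  | @pair S c p q hS hpq hp hq ih =>
    have cancel : ∀ u v w : Finset α, S ∆ (u ∆ v) ∆ (u ∆ w) = S ∆ (v ∆ w) := by
      intro u v w
      rw [symmDiff_assoc, symmDiff_symmDiff_symmDiff_comm, symmDiff_self, bot_symmDiff]
    rw [insert_insert_eq_symmDiff hpq hp hq]
    -- If the new edge shares an endpoint with the edge pq, the two form a path. The triangle
    -- inequality replaces it by one edge, which is added to the smaller matching by induction.
    by_cases hap : a = p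
    · subst hap
      obtain ⟨c', hc', h'⟩ := ih q b
      refine ⟨c', ?_, by rwa [cancel]⟩
      linarith [dist_triangle_left q b a]
    by_cases haq : a = q
    · subst haq
      obtain ⟨c', hc', h'⟩ := ih p b
      refine ⟨c', ?_, by rwa [symmDiff_comm ({p} : Finset α), cancel]⟩
      linarith [dist_triangle p a b]
    by_cases hbp : b = p
    · subst hbp
      obtain ⟨c', hc', h'⟩ := ih q a
      refine ⟨c', ?_, by rwa [symmDiff_comm ({a} : Finset α), cancel]⟩
      linarith [dist_triangle_left q a b, dist_comm a b]
    by_cases hbq : b = q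
    · subst hbq
      obtain ⟨c', hc', h'⟩ := ih p a
      refine ⟨c', ?_, by rwa [symmDiff_comm ({p} : Finset α), symmDiff_comm ({a} : Finset α), cancel]⟩
      linarith [dist_triangle p b a, dist_comm a b]
    obtain ⟨c', hc', h'⟩ := ih a b
    refine ⟨c' + dist p q, by linarith, ?_⟩
    have := h'.pair p q hpq
      (by simp [Finset.mem_symmDiff, hp, Ne.symm hap, Ne.symm hbp])
      (by simp [Finset.mem_symmDiff, hq, Ne.symm haq, Ne.symm hbq])
    rwa [insert_insert_eq_symmDiff hpq
      (by simp [Finset.mem_symmDiff, hp, Ne.symm hap, Ne.symm hbp])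
      (by simp [Finset.mem_symmDiff, hq, Ne.symm haq, Ne.symm hbq]), symmDiff_right_comm] at this

theorem HasMatching.symmDiff {A B : Finset α} {c d : ℝ} (hA : HasMatching A c)
    (hB : HasMatching B d) : ∃ e ≤ c + d, HasMatching (A ∆ B) e := by
  induction hB with
  | empty => exact ⟨c, by simp, by rwa [← Finset.bot_eq_empty, symmDiff_bot]⟩
  | pair a b _ hab ha hb ih =>
    obtain ⟨e, he, h⟩ := ih
    obtain ⟨e', he', h'⟩ := h.symmDiff_pair a b
    refine ⟨e', by linarith, ?_⟩
    rwa [insert_insert_eq_symmDiff hab ha hb, ← symmDiff_assoc]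

/-! ### Minimum weight matchings -/

theorem mwm_eq_sInf (S : Finset α) : mwm S = sInf {c : ℝ | HasMatching S c} := by
  unfold mwm
  congr 1
  ext c
  refine ⟨?_, fun h => h.exists_isPerfectMatching⟩
  rintro ⟨π, hπ, rfl⟩
  exact hπ.hasMatching

theorem HasMatching.mwm_le {S : Finset α} {c : ℝ} (h : HasMatching S c) : mwm S ≤ c :=
  csInf_le (bddBelow_matchingCosts S) h.exists_isPerfectMatching

theorem le_mwm {S : Finset α} (hS : Even S.card) {b : ℝ} (h : ∀ c, HasMatching S c → b ≤ c) :
    b ≤ mwm S := by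
  rw [mwm_eq_sInf]
  exact le_csInf (exists_hasMatching hS) h

/-- Evenness is essential: an odd set has no perfect matching, so its `mwm` is the default `sInf ∅ =
0`. -/
theorem mwm_symmDiff_le {A B : Finset α} (hA : Even A.card) (hB : Even B.card) :
    mwm (A ∆ B) ≤ mwm A + mwm B := by
  have h1 : ∀ d, HasMatching B d → mwm (A ∆ B) - d ≤ mwm A := fun d hd =>
    le_mwm hA fun c hc => by
      obtain ⟨e, he, h⟩ := hc.symmDiff hd
      linarith [h.mwm_le]
  have h2 : mwm (A ∆ B) - mwm A ≤ mwm B := le_mwm hB fun d hd => by linarith [h1 d hd]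
  linarith

theorem mwm_pair_le (a b : α) : mwm (({a} : Finset α) ∆ {b}) ≤ dist a b := by
  obtain ⟨c, hc, h⟩ := (HasMatching.empty (α := α)).symmDiff_pair a b
  rw [← Finset.bot_eq_empty, bot_symmDiff] at h
  linarith [h.mwm_le]

theorem mwm_empty : mwm (∅ : Finset α) = 0 :=
  le_antisymm HasMatching.empty.mwm_le (mwm_nonneg _)

theorem HasMatching.le_of_le_dist {S : Finset α} {c r : ℝ} (h : HasMatching S c)
    (hr : ∀ a ∈ S, ∀ b ∈ S, a ≠ b → r ≤ dist a b) : S.card * r ≤ 2 * c := by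
  induction h with
  | empty => simp
  | pair a b _ hab ha hb ih =>
    have h1 := ih fun x hx z hz => hr x (by simp [hx]) z (by simp [hz])
    have h2 := hr a (by simp) b (by simp) hab
    rw [Finset.card_insert_of_notMem (by simp [hab, ha]), Finset.card_insert_of_notMem hb]
    push_cast
    linarith

/-- Moving every point of `Z` along `f` and cancelling coinciding points in pairs. -/
theorem exists_mwm_symmDiff_le_sum (Z : Finset α) (f : α → α) :
    ∃ T ⊆ Z.image f, Even (Z ∆ T).card ∧ mwm (Z ∆ T) ≤ ∑ x ∈ Z, dist x (f x) := by
  induction Z using Finset.induction_on with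
  | empty => exact ⟨∅, by simp, by simp, by simp [mwm_empty]⟩
  | insert a Z ha ih =>
    obtain ⟨T, hT, he, hm⟩ := ih
    have hins : insert a Z = Z ∆ {a} := by
      ext x
      by_cases hx : x = a <;> simp_all [Finset.mem_symmDiff]
    have heq : insert a Z ∆ (T ∆ {f a}) = (Z ∆ T) ∆ ({a} ∆ {f a}) := by
      rw [hins, symmDiff_symmDiff_symmDiff_comm]
    refine ⟨T ∆ {f a}, ?_, ?_, ?_⟩
    · intro x hx
      rw [Finset.mem_symmDiff, Finset.mem_singleton] at hx
      rw [Finset.image_insert, Finset.mem_insert]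
      rcases hx with hx | hx
      · exact Or.inr (hT hx.1)
      · exact Or.inl hx.1
    · rw [heq, even_card_symmDiff]
      simp [he, even_card_pair_symmDiff]
    · rw [heq, Finset.sum_insert ha]
      linarith [mwm_symmDiff_le he (even_card_pair_symmDiff a (f a)), mwm_pair_le a (f a)]

/-! ### The effect of padding -/

variable {X : Finset α} {k : ℕ} {y : Fin k → α}

/-- Two points of one cell are within 2r of each other through their center, so padding costs at
most r per added point. -/
theorem padding_mwm_symmDiff_le {σ : α → Fin k} {r : ℝ} (hr : ∀ x ∈ X, dist x (y (σ x)) ≤ r)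
    {Z W : Finset α} (h : Relation.ReflTransGen (PadStep X y σ) Z W) :
    Even (W ∆ Z).card ∧ mwm (W ∆ Z) ≤ (W.card - Z.card) * r := by
  induction h with
  | refl => simp [mwm_empty]
  | tail _ hs ih =>
    obtain ⟨x, hx, x', hx', hσ, hc, he⟩ := hs.exists_eq_symmDiff
    obtain ⟨ih1, ih2⟩ := ih
    rw [he, symmDiff_right_comm]
    refine ⟨by rw [even_card_symmDiff]; simp [ih1, even_card_pair_symmDiff], ?_⟩
    rw [← he, hc]
    have hd : dist x x' ≤ 2 * r := by
      have h1 := hr x hx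
      have h2 := hr x' hx'
      rw [← hσ] at h2
      linarith [dist_triangle_right x x' (y (σ x))]
    push_cast
    linarith [mwm_symmDiff_le ih1 (even_card_pair_symmDiff x x'), mwm_pair_le x x']

/-! ### The returned set -/

/-- A repeated center would force covering radius 0, making every point of X one of at most k
centers. -/
theorem IsGMM.injective (hy : IsGMM X y) (hk : k < X.card) : Function.Injective y := by
  intro i j hij
  by_contra hne
  have hsub : X ⊆ centers y := by
    intro x hx
    have h0 : Metric.infDist x (Set.range y) = 0 :=
      le_antisymm (by simpa [hij] using hy.infDist_range_le hx hne) Metric.infDist_nonneg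
    have := ((Set.finite_range y).isClosed.mem_iff_infDist_zero ⟨y i, i, rfl⟩).2 h0
    simpa [centers] using this
  have h1 := Finset.card_le_card hsub
  have h2 : (centers y).card ≤ k := Finset.card_image_le.trans (by simp)
  omega

theorem IsGMM.centers_subset (hy : IsGMM X y) : centers y ⊆ X :=
  Finset.image_subset_iff.2 fun p _ => hy.1 p

theorem IsTrim.padding_spec (hy : IsGMM X y) (hk : Even k) {R : Finset (Fin k)} {σ : α → Fin k}
    {Z W : Finset α} (hZ : IsTrim (R.image y) Z)
    (hW : Relation.ReflTransGen (PadStep X y σ) Z W) : W ⊆ X ∧ Even W.card ∧ W.card ≤ k :=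
  padding_invariant hk (hZ.subset_centers.trans hy.centers_subset) hZ.even_card
    ((Finset.card_le_card hZ.subset_centers).trans (Finset.card_image_le.trans (by simp))) hW

theorem exists_isOutput (hk0 : 0 < k) (hn : 3 * k ≤ X.card)
    (R : Finset (Fin k)) : ∃ S, IsOutput X y R S := by
  obtain ⟨σ, hσ⟩ := exists_isAssignment X hk0 y
  obtain ⟨Z, hZ⟩ := exists_isTrim (R.image y)
  obtain ⟨W, hW, hWk⟩ := exists_padding (y := y) hn σ Z
  rcases le_total (mwm (centers y)) (mwm W) with h | h
  · exact ⟨W, σ, Z, W, hσ, hZ, hW, hWk, Or.inr rfl, h, le_rfl⟩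
  · exact ⟨centers y, σ, Z, W, hσ, hZ, hW, hWk, Or.inl rfl, le_rfl, h⟩

theorem IsOutput.subset_and_card (hy : IsGMM X y) (hinj : Function.Injective y) (hk : Even k)
    {R : Finset (Fin k)} {S : Finset α} (h : IsOutput X y R S) : S ⊆ X ∧ S.card = k := by
  obtain ⟨σ, Z, W, -, hZ, hW, hWk, rfl | rfl, -, -⟩ := h
  · exact ⟨hy.centers_subset, card_centers hinj⟩
  · obtain ⟨h1, -, h3⟩ := hZ.padding_spec hy hk hW
    exact ⟨h1, by omega⟩

/-- The optimum is approximated by an even set of centers. -/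
theorem exists_even_image (hk0 : 0 < k) (hk : Even k) (hn : k ≤ X.card)
    {r : ℝ} (hr : ∀ σ, IsAssignment X y σ → ∀ x ∈ X, dist x (y (σ x)) ≤ r)
    (hinj : Function.Injective y) :
    ∃ U : Finset (Fin k), Even U.card ∧ mwmOpt X k ≤ mwm (U.image y) + k * r := by
  obtain ⟨Z, hZX, hZk, hopt⟩ := exists_eq_mwmOpt hn
  obtain ⟨σ, hσ⟩ := exists_isAssignment X hk0 y
  obtain ⟨T, hT, he, hm⟩ := exists_mwm_symmDiff_le_sum Z fun x => y (σ x)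
  have hZe : Even Z.card := by rwa [hZk]
  have hTe : Even T.card := ((even_card_symmDiff Z T).1 he).1 hZe
  have hTy : T ⊆ (Finset.univ : Finset (Fin k)).image y := by
    intro x hx
    obtain ⟨z, -, rfl⟩ := Finset.mem_image.1 (hT hx)
    exact Finset.mem_image_of_mem _ (Finset.mem_univ _)
  obtain ⟨U, -, rfl⟩ := Finset.subset_image_iff.1 hTy
  refine ⟨U, by rwa [Finset.card_image_of_injective _ hinj] at hTe, ?_⟩
  have hsum : ∑ x ∈ Z, dist x (y (σ x)) ≤ k * r := by
    have := Finset.sum_le_card_nsmul Z _ r fun x hx => hr σ hσ x (hZX hx)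
    rwa [hZk, nsmul_eq_mul] at this
  -- Z is recovered as (Z ∆ T) ∆ T.
  have htri := mwm_symmDiff_le he hTe
  rw [symmDiff_symmDiff_cancel_right] at htri
  linarith

theorem IsOutput.isApprox (hy : IsGMM X y) (hinj : Function.Injective y) (hk : Even k)
    {r : ℝ} (hr0 : 0 ≤ r) (hr : ∀ σ, IsAssignment X y σ → ∀ x ∈ X, dist x (y (σ x)) ≤ r)
    (hsep : ∀ i j, i ≠ j → r ≤ dist (y i) (y j)) {U R : Finset (Fin k)}
    (hU : mwmOpt X k ≤ mwm (U.image y) + k * r) (hRe : Even R.card)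
    (hR : mwm (U.image y) ≤ 2 * mwm (R.image y)) {S : Finset α} (h : IsOutput X y R S) :
    IsApprox 65 X k S := by
  obtain ⟨hSX, hSk⟩ := h.subset_and_card hy hinj hk
  obtain ⟨σ, Z, W, hσ, hZ, hW, hWk, -, hYS, hWS⟩ := h
  refine ⟨hSX, hSk, ?_⟩
  obtain ⟨-, hWe, hWk'⟩ := hZ.padding_spec hy hk hW
  have hZR : Z = R.image y := hZ.eq_of_even (by rwa [Finset.card_image_of_injective _ hinj])
  obtain ⟨hDe, hD⟩ := padding_mwm_symmDiff_le (hr σ hσ) hW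
  have htri := mwm_symmDiff_le hWe hDe
  rw [symmDiff_symmDiff_cancel_left, hZR] at htri
  rw [hZR] at hD
  have hDk : ((W.card : ℝ) - (R.image y).card) * r ≤ k * r := by
    refine mul_le_mul_of_nonneg_right ?_ hr0
    have h1 : (W.card : ℝ) ≤ k := by exact_mod_cast hWk'
    have h2 : (0 : ℝ) ≤ (R.image y).card := Nat.cast_nonneg _
    linarith
  -- Any matching of the centers consists of k / 2 edges of length at least r.
  have hY : (k : ℝ) * r / 2 ≤ mwm (centers y) := by
    refine le_mwm (by rwa [card_centers hinj]) fun c hc => ?_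
    have := hc.le_of_le_dist (r := r) (by
      intro a ha b hb hab
      obtain ⟨i, -, rfl⟩ := Finset.mem_image.1 ha
      obtain ⟨j, -, rfl⟩ := Finset.mem_image.1 hb
      exact hsep i j fun e => hab (by rw [e]))
    rw [card_centers hinj] at this
    linarith
  have := mwm_nonneg S
  linarith

/-! ### Counting successful subsets -/

/-- If `f` is subadditive under symmetric difference, then a quarter of all subsets are of even
size and carry at least half of the value of a given even set `U`. -/
theorem card_le_four_mul_card_filter {β : Type*} [Fintype β] [DecidableEq β] [Nonempty β]
    (f : Finset β → ℝ) (U : Finset β) (hU : Even U.card)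
    (hf : ∀ A : Finset β, Even A.card → f U ≤ f A + f (A ∆ U)) :
    Fintype.card (Finset β) ≤
      4 * (Finset.univ.filter fun A : Finset β => Even A.card ∧ f U ≤ 2 * f A).card := by
  obtain ⟨b⟩ := ‹Nonempty β›
  set E := Finset.univ.filter fun A : Finset β => Even A.card
  set O := Finset.univ.filter fun A : Finset β => ¬ Even A.card
  set G := Finset.univ.filter fun A : Finset β => Even A.card ∧ f U ≤ 2 * f A
  have hEO : E.card + O.card = Fintype.card (Finset β) := by
    rw [← Finset.card_univ]
    exact Finset.card_filter_add_card_filter_not (s := (Finset.univ : Finset (Finset β)))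
      (fun A : Finset β => Even A.card)
  -- Toggling the fixed element b turns odd sets into even ones injectively.
  have hOE : O.card ≤ E.card := by
    refine Finset.card_le_card_of_injOn (fun A => A ∆ {b}) ?_
      (symmDiff_left_injective _).injOn
    intro A hA
    simp only [O, E, Finset.coe_filter, Finset.mem_univ, true_and, Set.mem_ofPred_eq] at hA ⊢
    rw [even_card_symmDiff]
    simp [hA]
  have hGE : G ⊆ E := fun A hA => by
    simp only [G, E, Finset.mem_filter, Finset.mem_univ, true_and] at hA ⊢
    exact hA.1
  -- If an even A carries less than half of f U, then A ∆ U carries more than half.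
  have hEG : (E \ G).card ≤ G.card := by
    refine Finset.card_le_card_of_injOn (fun A => A ∆ U) ?_
      (symmDiff_left_injective _).injOn
    intro A hA
    simp only [G, E, Finset.coe_sdiff, Finset.coe_filter, Finset.mem_univ, true_and, Set.mem_sdiff,
      Set.mem_ofPred_eq, not_and, not_le] at hA ⊢
    refine ⟨by rw [even_card_symmDiff]; simp [hA.1, hU], ?_⟩
    linarith [hf A hA.1, hA.2 hA.1]
  have := Finset.card_sdiff_add_card_eq_card hGE
  omega

theorem IsGMM.card_le_four_mul_card (hy : IsGMM X y) (hk0 : 0 < k) (hk : Even k)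
    (hn : 3 * k ≤ X.card) (G : Finset (Finset (Fin k)))
    (hG : ∀ R, R ∈ G ↔ ∀ S, IsOutput X y R S → IsApprox 65 X k S) :
    Fintype.card (Finset (Fin k)) ≤ 4 * G.card := by
  have hinj := hy.injective (by omega)
  obtain ⟨r, hr0, hr, hsep⟩ := hy.exists_radius (Finset.card_pos.1 (by omega))
  obtain ⟨U, hUe, hU⟩ := exists_even_image hk0 hk (by omega) hr hinj
  have : Nonempty (Fin k) := ⟨⟨0, hk0⟩⟩
  refine (card_le_four_mul_card_filter (fun A => mwm (A.image y)) U hUe ?_).trans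
    (Nat.mul_le_mul_left 4 (Finset.card_le_card ?_))
  · intro A hA
    have hAU : Even (A ∆ U).card := by rw [even_card_symmDiff]; simp [hA, hUe]
    have := mwm_symmDiff_le (A := A.image y) (B := (A ∆ U).image y)
      (by rwa [Finset.card_image_of_injective _ hinj])
      (by rwa [Finset.card_image_of_injective _ hinj])
    rwa [← Finset.image_symmDiff _ _ hinj, symmDiff_symmDiff_cancel_left] at this
  · intro R hR
    simp only [Finset.mem_filter, Finset.mem_univ, true_and] at hR
    exact (hG R).2 fun S hS => hS.isApprox hy hinj hk hr0 hr hsep hU hR.1 hR.2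

end Matching

/-! ### Uniform probability and independent repetitions -/

theorem ofReal_le_uniformOfFintype {β : Type*} [Fintype β] [Nonempty β] (E : Set β)
    (G : Finset β) (hG : ∀ b ∈ G, b ∈ E) (p : ℝ) (h : p * Fintype.card β ≤ G.card) :
    ENNReal.ofReal p ≤ (PMF.uniformOfFintype β).toOuterMeasure E := by
  classical
  have hpos : (0 : ℝ) < Fintype.card β := by exact_mod_cast Fintype.card_pos
  refine le_trans ?_ ((PMF.uniformOfFintype β).toOuterMeasure.mono (s₁ := (G : Set β)) hG)
  change _ ≤ (PMF.uniformOfFintype β).toOuterMeasure (G : Set β)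
  rw [PMF.toOuterMeasure_uniformOfFintype_apply,
    show Fintype.card (G : Set β) = G.card from Fintype.card_coe G,
    ← ENNReal.ofReal_natCast, ← ENNReal.ofReal_natCast, ← ENNReal.ofReal_div_of_pos hpos]
  exact ENNReal.ofReal_le_ofReal ((le_div_iff₀ hpos).2 h)

/-- Among tuples of elements, those that avoid every `G t` are rare. -/
theorem one_sub_mul_card_le {β : Type*} [Fintype β] [DecidableEq β] {T : ℕ}
    (G : Fin T → Finset β) {p : ℝ} (hG : ∀ t, p * Fintype.card β ≤ (G t).card) :
    (1 - Real.exp (-(T * p))) * Fintype.card (Fin T → β) ≤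
      (Finset.univ.filter fun R : Fin T → β => ∃ t, R t ∈ G t).card := by
  have hbad : (Finset.univ.filter fun R : Fin T → β => ¬ ∃ t, R t ∈ G t)
      = Fintype.piFinset fun t => (G t)ᶜ := by
    ext R
    simp
  have hsum := Finset.card_filter_add_card_filter_not
    (s := (Finset.univ : Finset (Fin T → β))) (fun R => ∃ t, R t ∈ G t)
  rw [hbad, Fintype.card_piFinset, Finset.card_univ] at hsum
  -- Each factor is at most (1 - p) |β| ≤ exp(-p) |β|.
  have hprod : ∏ t, (((G t)ᶜ).card : ℝ) ≤ ∏ _t : Fin T, Real.exp (-p) * Fintype.card β := by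
    refine Finset.prod_le_prod (fun _ _ => Nat.cast_nonneg _) fun t _ => ?_
    have h1 : (((G t)ᶜ).card : ℝ) = Fintype.card β - (G t).card := by
      rw [← Finset.card_add_card_compl (G t)]
      push_cast
      ring
    have h2 := mul_le_mul_of_nonneg_right (Real.one_sub_le_exp_neg p)
      (Nat.cast_nonneg (α := ℝ) (Fintype.card β))
    linarith [hG t]
  have hexp : ∏ _t : Fin T, Real.exp (-p) * (Fintype.card β : ℝ)
      = Real.exp (-(T * p)) * Fintype.card (Fin T → β) := by
    simp [mul_pow, ← Real.exp_nat_mul]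
  rw [hexp] at hprod
  have hsum' : ((Finset.univ.filter fun R : Fin T → β => ∃ t, R t ∈ G t).card : ℝ)
      + ∏ t, (((G t)ᶜ).card : ℝ) = Fintype.card (Fin T → β) := by
    exact_mod_cast hsum
  linarith

end RemoteMatching

theorem theorem1 {α : Type*} [MetricSpace α] [DecidableEq α] (X : Finset α) (k : ℕ)
    (hk0 : 0 < k) (hk : Even k) (hn : 3 * k ≤ X.card) :
    -- GMM can be run for `k` steps
    (∃ y : Fin k → α, IsGMM X y) ∧
    -- whatever it returns, the algorithm never gets stuck, always returns a set,
    -- and one run succeeds with probability at least 1/4096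
    (∀ y : Fin k → α, IsGMM X y →
      (∀ (R : Finset (Fin k)) (σ : α → Fin k) (Z W : Finset α),
        IsAssignment X y σ → IsTrim (R.image y) Z →
        Relation.ReflTransGen (PadStep X y σ) Z W → W.card < k →
        ∃ W', PadStep X y σ W W') ∧
      (∀ R : Finset (Fin k), ∃ S, IsOutput X y R S) ∧
      (1 / 4096 : ENNReal) ≤
        (PMF.uniformOfFintype (Finset (Fin k))).toOuterMeasure
          {R | ∀ S, IsOutput X y R S → IsApprox 65 X k S}) ∧
    -- amplification: the best of `T` independent runs, with `T` depending on `δ` only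
    (∀ (δ : ℝ), 0 < δ → ∀ T : ℕ, 4096 * Real.log (1 / δ) ≤ T →
      ∀ y : Fin T → Fin k → α, (∀ t, IsGMM X (y t)) →
        ENNReal.ofReal (1 - δ) ≤
          (PMF.uniformOfFintype (Fin T → Finset (Fin k))).toOuterMeasure
            {R | ∀ S, IsRepeatedOutput X y R S → IsApprox 65 X k S}) := by
  classical
  let G : (Fin k → α) → Finset (Finset (Fin k)) := fun y =>
    Finset.univ.filter fun R => ∀ S, IsOutput X y R S → IsApprox 65 X k S
  have hmem : ∀ y R, R ∈ G y ↔ ∀ S, IsOutput X y R S → IsApprox 65 X k S := by simp [G]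
  have hG : ∀ y, IsGMM X y →
      (1 / 4096 : ℝ) * Fintype.card (Finset (Fin k)) ≤ (G y).card := fun y hy => by
    have h : (Fintype.card (Finset (Fin k)) : ℝ) ≤ 4 * (G y).card := by
      exact_mod_cast hy.card_le_four_mul_card hk0 hk hn (G y) (hmem y)
    linarith [Nat.cast_nonneg (α := ℝ) (G y).card]
  refine ⟨exists_isGMM (Finset.card_pos.1 (by omega)) k, fun y hy => ⟨?_, ?_, ?_⟩, ?_⟩
  · intro _ σ _ _ _ _ _ hlt
    exact exists_padStep hn σ hlt
  · exact exists_isOutput hk0 hn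
  · have h := ofReal_le_uniformOfFintype {R | ∀ S, IsOutput X y R S → IsApprox 65 X k S} (G y)
      (fun R hR => (hmem y R).1 hR) (1 / 4096) (hG y hy)
    rwa [ENNReal.ofReal_div_of_pos (by norm_num), ENNReal.ofReal_one,
      ENNReal.ofReal_ofNat] at h
  · intro δ hδ T hT y hy
    refine ofReal_le_uniformOfFintype _
      (Finset.univ.filter fun R : Fin T → Finset (Fin k) => ∃ t, R t ∈ G (y t)) ?_ _
      (le_trans (mul_le_mul_of_nonneg_right ?_ (Nat.cast_nonneg _))
        (one_sub_mul_card_le (fun t => G (y t)) fun t => hG (y t) (hy t)))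
    -- One good run t suffices: S may come from another run s, but it is still a k-subset of X and
    -- costs at least as much as `Q t`.
    · intro R hR S hS
      obtain ⟨t, ht⟩ := (Finset.mem_filter.1 hR).2
      obtain ⟨Q, hQ, ⟨s, rfl⟩, hmax⟩ := hS
      obtain ⟨h1, h2⟩ := (hQ s).subset_and_card (hy s) ((hy s).injective (by omega)) hk
      exact ⟨h1, h2, ((hmem _ _).1 ht _ (hQ t)).2.2.trans (hmax t)⟩
    · have h : -(T * (1 / 4096 : ℝ)) ≤ Real.log δ := by
        rw [one_div, Real.log_inv] at hT
        linarith
      have := (Real.exp_le_exp.2 h).trans_eq (Real.exp_log hδ)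
      linarith
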